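/- Let $q$ be a power of an odd prime, let $R=\mathbf F_q[T]$ and $k=\mathbf F_q(T)$. Let $a\in R\setminus\mathbf F_q$ be such that $A=2a+1$ is monic, let $m\ge 1$ be an integer, and let $D\in R$ be square-free. Let $K=k(\sqrt D)$, and let $h(D)$ be the ideal class number of $K$, that is, the order of the ideal class group of the integral closure $\mathcal O_K$ of $R$ in $K$. Let $P\in R$ be an irreducible polynomial that splits in $K$, that is, $P\mathcal O_K$ is a product of two distinct prime ideals of $\mathcal O_K$. Then: (1) if $D=(A^m+a)^2+A$, and it is not the case that both $m=1$ and $\operatorname{char}\mathbf F_q=3$, then $h(D)\ge \deg A/\deg P$; (2) if $D=(A^m-a)^2+A$, then $h(D)\ge \deg A/\deg P$; (3) if $D=(A^m+a+1)^2-A$, and it is not the case that both $m=1$ and $\operatorname{char}\mathbf F_q=3$, then $h(D)\ge \deg A/\deg P$; (4) if $D=(A^m-a-1)^2-A$, then $h(D)\ge \deg A/\deg P$. -/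

import Mathlib

open scoped Polynomial

noncomputable section

/-- `K` is the field `F(X)(√D)`: it is generated over `F(X)` by a square root of the
polynomial `D`. -/
def IsAdjoinSqrt (F K : Type*) [Field F] [Field K] [Algebra F[X] K] [Algebra (RatFunc F) K]
    (D : F[X]) : Prop :=
  ∃ s : K, s ^ 2 = algebraMap F[X] K D ∧ IntermediateField.adjoin (RatFunc F) {s} = ⊤

/-- The ideal class number of `K`: the number of ideal classes of the integral closure
of `F[X]` in `K`. -/
def idealClassNumber (F K : Type*) [Field F] [Field K] [Algebra F[X] K] : ℕ :=
  Nat.card (ClassGroup (FunctionField.ringOfIntegers F K))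

/-- The polynomial `P` splits in the quadratic extension `K` of `F(X)`: the ideal it generates
in the integral closure of `F[X]` in `K` is the product of two distinct prime ideals. -/
def SplitsInQuadratic (F K : Type*) [Field F] [Field K] [Algebra F[X] K] (P : F[X]) : Prop :=
  ∃ p₁ p₂ : Ideal (FunctionField.ringOfIntegers F K), p₁.IsPrime ∧ p₂.IsPrime ∧ p₁ ≠ p₂ ∧
    Ideal.span {algebraMap F[X] (FunctionField.ringOfIntegers F K) P} = p₁ * p₂

end

/-! All four families have the form `D = B ^ 2 + e * A` with `2 * B = 2 * A ^ m + c * (e * A - 1)`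
and `c, e = ±1`. Write `s = √D`. Then `θ = B + s` has norm `-e * A`, `η = B + c + s` has norm `2 * c
* A ^ m`, and `ε = η * θ ^ m / A ^ m` is a unit (`exists_unit_of_sqrt`).

At a place at infinity where `θ` is large, `ε` has the size of `A ^ (m * m)`, so any integral
element can be moved by a power of `ε` to a size between 1 and that of `A ^ (m * m)`. In that range,
norm smaller than `A` forces the element into `F[X]` (`coeff_eq_zero_of_small_norm`). Hence an
integral element whose norm has degree below `deg A` is a polynomial times a unit.

Let `P` split as `p * q` and let `h` be the class number. The generators of `p ^ h` and `q ^ h` are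
not of that kind (`pow_ne_span_algebraMap`), so their norms have degree at least `deg A`. The
product of these norms is `P ^ (2 * h)` up to a constant, which gives `h * deg P ≥ deg A`. -/

/-- The ideal with `F[X]`-basis `A ^ j, B + c + t` is mapped by `B - t` into the one with basis
`A ^ (j + 1), B + c + t`. -/
theorem exists_mul_pow_eq {R K : Type*} [CommRing R] [CommRing K] [Algebra R K]
    {A B D c e : R} {m : ℕ} (hc : c ^ 2 = 1)
    (hB : 2 * B = 2 * A ^ m + c * (e * A - 1)) (hD : D = B ^ 2 + e * A) (x₀ y₀ : R) :
    ∀ j ≤ m, ∃ x y : R, ∀ t : K, t ^ 2 = algebraMap R K D →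
      (algebraMap R K x₀ + algebraMap R K y₀ * (algebraMap R K (B + c) + t)) *
        (algebraMap R K B - t) ^ j =
      algebraMap R K (x * A ^ j) + algebraMap R K y * (algebraMap R K (B + c) + t) := by
  intro j
  induction j with
  | zero => exact fun _ ↦ ⟨x₀, y₀, fun t _ ↦ by simp⟩
  | succ j ih =>
    intro hj
    obtain ⟨x, y, hxy⟩ := ih (by omega)
    obtain ⟨n, rfl⟩ : ∃ n, m = n + 1 + j := ⟨m - (j + 1), by omega⟩
    -- With `η = B + c + t`, the witnesses come from `B - t = 2 * A ^ m + c * e * A - η` and `η * (B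
    -- - t) = 2 * c * A ^ m - c * η`; `j < m` lets `A ^ (j + 1)` be factored out of `A ^ m`.
    refine ⟨x * (2 * A ^ (n + j) + c * e) + 2 * c * y * A ^ n, -x * A ^ j - c * y, fun t ht ↦ ?_⟩
    rw [pow_succ, ← mul_assoc, hxy t ht]
    have h1 := congrArg (algebraMap R K) hB
    have h2 := congrArg (algebraMap R K) hD
    have h3 := congrArg (algebraMap R K) hc
    rw [← ht] at h2
    simp only [map_add, map_mul, map_sub, map_pow, map_neg, map_one, map_ofNat] at h1 h2 h3 ⊢
    generalize algebraMap R K A = A at *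
    generalize algebraMap R K B = B at *
    generalize algebraMap R K c = c at *
    generalize algebraMap R K e = e at *
    generalize algebraMap R K x = x at *
    generalize algebraMap R K y = y at *
    linear_combination (x * A ^ j + c * y) * h1 - y * h2 + y * e * A * h3

/-! ### Elements of small norm at a place at infinity -/

section Core

variable {R K Γ : Type*} [CommRing R] [Field K] [Algebra R K]
  [LinearOrderedCommGroupWithZero Γ]

theorem Valuation.eq_zero_of_lt_one {v : Valuation K Γ}
    (hv : ∀ x : R, x ≠ 0 → 1 ≤ v (algebraMap R K x)) {x : R} (hx : v (algebraMap R K x) < 1) :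
    x = 0 := by
  by_contra h
  exact absurd hx (not_lt.2 (hv x h))

theorem Valuation.eq_one_of_sq {v : Valuation K Γ} {c : K} (hc : c ^ 2 = 1) : v c = 1 := by
  have := congrArg v hc
  rw [map_pow, map_one] at this
  exact (pow_eq_one_iff_of_nonneg zero_le two_ne_zero).1 this

theorem exists_pow_le_lt_pow {g a : Γ} (ha : 1 ≤ a) (m n : ℕ) (h : a < g ^ (m * n)) :
    ∃ j < n, g ^ (m * j) ≤ a ∧ a < g ^ (m * (j + 1)) := by
  induction n with
  | zero => simp at h; exact absurd ha (not_le.2 h)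
  | succ n ih =>
    rcases lt_or_ge a (g ^ (m * n)) with h' | h'
    · obtain ⟨j, hj, h1⟩ := ih h'
      exact ⟨j, by omega, h1⟩
    · exact ⟨n, by omega, h', h⟩

variable {v : Valuation K Γ} {A B D c e : R} {m : ℕ} {s : K}

/-- Multiplying `α = x₀ + y₀ * s` by a suitable power `(B - s) ^ j` brings it to `γ = x * A ^ j + y
* η` with `g ^ j ≤ v γ < g ^ (j + m)` and norm below `g ^ (j + 1)`. If `y ≠ 0`, the conjugate of `γ`
is so small that `γ` must be a multiple of `A ^ j * (B + s)`, which is too large. -/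
theorem coeff_eq_zero_of_small_norm
    (hv : ∀ x : R, x ≠ 0 → 1 ≤ v (algebraMap R K x)) (hinj : Function.Injective (algebraMap R K))
    (h2 : v 2 = 1) (hm : 1 ≤ m) (hc : c ^ 2 = 1) (he : e ^ 2 = 1)
    (hB : 2 * B = 2 * A ^ m + c * (e * A - 1)) (hD : D = B ^ 2 + e * A)
    (hs : s ^ 2 = algebraMap R K D) (hA : 1 < v (algebraMap R K A))
    (hvs : v s = v (algebraMap R K A) ^ m)
    (hBs : v (algebraMap R K B + s) = v (algebraMap R K A) ^ m) (x₀ y₀ : R)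
    (hα0 : 1 ≤ v (algebraMap R K x₀ + algebraMap R K y₀ * s))
    (hα1 : v (algebraMap R K x₀ + algebraMap R K y₀ * s) < v (algebraMap R K A) ^ (m * m))
    (hN : v ((algebraMap R K x₀ + algebraMap R K y₀ * s) *
      (algebraMap R K x₀ - algebraMap R K y₀ * s)) < v (algebraMap R K A)) : y₀ = 0 := by
  set φ := algebraMap R K with hφ
  set g := v (φ A) with hg
  have hg0 : 0 < g := lt_trans zero_lt_one hA
  have hθθ : (φ B + s) * (φ B - s) = - (φ e * φ A) := by
    have := congrArg φ hD
    rw [← hs] at this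
    simp only [map_add, map_mul, map_pow] at this
    linear_combination -this
  have hve : v (φ e) = 1 := Valuation.eq_one_of_sq (by rw [← map_pow, he, map_one])
  have hvc : v (φ c) = 1 := Valuation.eq_one_of_sq (by rw [← map_pow, hc, map_one])
  have hθ' : g ^ m * v (φ B - s) = g := by
    have := congrArg v hθθ
    rwa [map_mul, Valuation.map_neg, map_mul, hve, one_mul, hBs] at this
  obtain ⟨j, hj, hj1, hj2⟩ := exists_pow_le_lt_pow hα0 m m hα1
  obtain ⟨x, y, hxy⟩ := exists_mul_pow_eq (K := K) hc hB hD (x₀ - y₀ * (B + c)) y₀ j hj.le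
  -- The same `x, y` serve both square roots, so `γ'` below is the conjugate of `γ` although no
  -- automorphism is available here.
  have e1 := hxy s hs
  have e2 := hxy (-s) (by rw [neg_sq, hs])
  have t1 : φ (x₀ - y₀ * (B + c)) + φ y₀ * (φ (B + c) + s) = φ x₀ + φ y₀ * s := by
    simp only [map_sub, map_mul]; ring
  have t2 : φ (x₀ - y₀ * (B + c)) + φ y₀ * (φ (B + c) + -s) = φ x₀ - φ y₀ * s := by
    simp only [map_sub, map_mul]; ring
  rw [← hφ, t1] at e1
  rw [← hφ, t2, sub_neg_eq_add] at e2
  set α := φ x₀ + φ y₀ * s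
  set α' := φ x₀ - φ y₀ * s
  set γ := φ (x * A ^ j) + φ y * (φ (B + c) + s) with hγ
  set γ' := φ (x * A ^ j) + φ y * (φ (B + c) + -s) with hγ'
  have hγ1 : g ^ j ≤ v γ := by
    calc g ^ j = g ^ (m * j) * v (φ B - s) ^ j := by rw [pow_mul, ← mul_pow, hθ']
      _ ≤ v α * v (φ B - s) ^ j := mul_le_mul_left hj1 _
      _ = v γ := by rw [← e1, map_mul, map_pow]
  have hγ2 : v γ < g ^ (j + m) := by
    have hw : 0 < v (φ B - s) := by
      refine pos_of_ne_zero fun h ↦ ?_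
      rw [h, mul_zero] at hθ'
      exact hg0.ne hθ'
    calc v γ = v α * v (φ B - s) ^ j := by rw [← e1, map_mul, map_pow]
      _ < g ^ (m * (j + 1)) * v (φ B - s) ^ j := by
        exact mul_lt_mul_of_pos_right hj2 (pow_pos hw _)
      _ = g ^ m * (g ^ m * v (φ B - s)) ^ j := by
        rw [mul_pow, mul_add, mul_one, pow_add, ← pow_mul, mul_comm (g ^ (m * j)), mul_assoc]
      _ = g ^ (j + m) := by rw [hθ', add_comm, pow_add]
  have hN' : v γ * v γ' < g ^ (j + 1) := by
    have : γ * γ' = α * α' * (-(φ e * φ A)) ^ j := by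
      rw [← e1, ← e2, ← hθθ, mul_pow]; ring
    rw [← map_mul, this, map_mul v (α * α'), map_pow, Valuation.map_neg, map_mul v (φ e), hve, one_mul, pow_succ']
    exact mul_lt_mul_of_pos_right hN (pow_pos hg0 _)
  by_cases hy : y = 0
  · have h0 : γ = γ' := by rw [hγ, hγ', hy]; simp
    -- A self-conjugate `γ` has norm of size at least `g ^ (2 * j)`, which is below `g ^ (j + 1)`
    -- only for `j = 0`; then `α = γ`.
    have hj0 : j = 0 := by
      by_contra hj0
      have h1 : g ^ j * g ^ j < g ^ (j + 1) := by
        refine lt_of_le_of_lt (mul_le_mul' hγ1 ?_) hN'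
        rw [← h0]; exact hγ1
      rw [← pow_add] at h1
      exact absurd h1 (not_lt.2 (pow_le_pow_right₀ hA.le (by omega)))
    rw [hj0, pow_zero, mul_one] at e1 e2
    have h1 : 2 * s * φ y₀ = 0 := by
      have : α - α' = 0 := by rw [e1, e2, h0, sub_self]
      rw [← this]; ring
    have h20 : (2 : K) ≠ 0 := fun h ↦ by rw [h, map_zero] at h2; exact zero_ne_one h2
    have hs0 : s ≠ 0 := fun h ↦ by
      rw [h, map_zero] at hvs; exact (pow_pos hg0 m).ne hvs
    have h3 := (mul_eq_zero.1 h1).resolve_left (mul_ne_zero h20 hs0)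
    exact hinj (h3.trans (map_zero _).symm)
  · exfalso
    have hvy : 1 ≤ v (φ y) := hv y hy
    have hdiff : γ - γ' = 2 * (φ y * s) := by rw [hγ, hγ']; ring
    have hvd : v (γ - γ') = v (φ y) * g ^ m := by
      rw [hdiff, map_mul, map_mul, h2, one_mul, hvs]
    have hgm : 1 ≤ g ^ m := one_le_pow₀ hA.le
    have hγ'g : v γ' < g := by
      by_contra h
      exact absurd hN' (not_lt.2 (by rw [pow_succ]; exact mul_le_mul' hγ1 (not_lt.1 h)))
    have hγ'm : v γ' < v (φ y) * g ^ m := by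
      refine hγ'g.trans_le ?_
      calc g ≤ g ^ m := le_self_pow₀ hA.le (by omega)
        _ ≤ _ := le_mul_of_one_le_left' hvy
    have hγy : v γ = v (φ y) * g ^ m := by
      rw [← hvd] at hγ'm ⊢
      rw [← Valuation.map_add_eq_of_lt_left _ hγ'm, sub_add_cancel]
    have hγ'1 : v γ' < 1 := by
      by_contra h
      refine absurd hN' (not_lt.2 ?_)
      calc g ^ (j + 1) ≤ g ^ m := pow_le_pow_right₀ hA.le (by omega)
        _ ≤ v γ := by rw [hγy]; exact le_mul_of_one_le_left' hvy
        _ ≤ v γ * v γ' := le_mul_of_one_le_right' (not_lt.1 h)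
    have hyθ : v (φ y * (φ B - s)) < 1 := by
      have h1 : v (φ y) < g ^ j := by
        rw [hγy, pow_add] at hγ2
        exact lt_of_mul_lt_mul_right' hγ2
      have h3 : g ^ m * v (φ y * (φ B - s)) < g ^ m * 1 := by
        calc g ^ m * v (φ y * (φ B - s)) = v (φ y) * (g ^ m * v (φ B - s)) := by
              rw [map_mul]; exact mul_left_comm _ _ _
          _ = v (φ y) * g := by rw [hθ']
          _ < g ^ j * g := mul_lt_mul_of_pos_right h1 hg0
          _ = g ^ (j + 1) := (pow_succ _ _).symm
          _ ≤ g ^ m := pow_le_pow_right₀ hA.le (by omega)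
          _ = g ^ m * 1 := (mul_one _).symm
      exact lt_of_mul_lt_mul_left' h3
    -- This is `γ' - y * (B - s)`, an element of `R` of valuation below 1.
    have hz : x * A ^ j + c * y = 0 := by
      refine Valuation.eq_zero_of_lt_one (v := v) hv ?_
      have : φ (x * A ^ j + c * y) = γ' - φ y * (φ B - s) := by
        rw [hγ']; simp only [map_add, map_mul]; ring
      rw [← hφ, this]
      exact Valuation.map_sub_lt _ hγ'1 hyθ
    have hγx : γ = - (φ c * φ x * φ A ^ j * (φ B + s)) := by
      have h3 : y = -(c * x * A ^ j) := by linear_combination c * hz - y * hc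
      have h4 : φ c ^ 2 = 1 := by rw [← map_pow, hc, map_one]
      rw [hγ, h3]
      simp only [map_add, map_mul, map_neg, map_pow]
      linear_combination (-φ x * φ A ^ j) * h4
    have hx : x ≠ 0 := by
      rintro rfl
      apply hy
      linear_combination c * hz - y * hc
    refine absurd hγ2 (not_lt.2 ?_)
    rw [hγx, Valuation.map_neg, map_mul, map_mul, map_mul, map_pow, hvc, one_mul, hBs, pow_add]
    exact mul_le_mul' (le_mul_of_one_le_left' (hv x hx)) le_rfl
end Core

/-- The value group need not be archimedean, so powers of `w` must be assumed to dominate `a` and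
`b`. In the application `b` belongs to the conjugate of the element of size `a`, and `1 ≤ a * b`
keeps `a` from being too small. -/
theorem exists_zpow_mem_Ico {Γ : Type*} [LinearOrderedCommGroupWithZero Γ] {a b w : Γ}
    (hab : 1 ≤ a * b) (hw : 1 < w) {n n' : ℕ} (hn : a ≤ w ^ n) (hn' : b ≤ w ^ n') :
    ∃ k : ℤ, 1 ≤ a * w ^ k ∧ a * w ^ k < w := by
  have hw0 : 0 < w := zero_lt_one.trans hw
  obtain ⟨k, hk, hmin⟩ := Int.exists_least_of_bdd (P := fun k : ℤ ↦ 1 ≤ a * w ^ k)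
    ⟨-n, fun z hz ↦ by
      by_contra h
      have h1 : a * w ^ z ≤ w ^ ((n : ℤ) + z) := by
        rw [zpow_add₀ hw0.ne', zpow_natCast]; exact mul_le_mul_left hn _
      have h2 : w ^ ((n : ℤ) + z) < 1 := zpow_lt_one_of_neg₀ hw (by omega)
      exact absurd hz (not_le.2 (h1.trans_lt h2))⟩
    ⟨n', hab.trans (by rw [zpow_natCast]; exact mul_le_mul_right hn' _)⟩
  refine ⟨k, hk, ?_⟩
  by_contra h
  have h1 := hmin (k - 1) (by
    rw [zpow_sub₀ hw0.ne', zpow_one, ← mul_div_assoc]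
    exact (one_le_div₀ hw0).2 (not_lt.1 h))
  omega

/-! ### Valuations at infinity and degrees -/

section Valuation

variable {F K : Type*} [Field F] [Field K] [Algebra F[X] K]

/-- A valuation of `K` above the place at infinity of `F(X)`. -/
theorem exists_valuationSubring_infty (hinj : Function.Injective (algebraMap F[X] K)) :
    ∃ V : ValuationSubring K, 1 < V.valuation (algebraMap F[X] K Polynomial.X) ∧
      ∀ c : F, V.valuation (algebraMap F[X] K (Polynomial.C c)) ≤ 1 := by
  let f : F →+* K := (algebraMap F[X] K).comp Polynomial.C
  let : Algebra F K := f.toAlgebra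
  -- A monic equation for `X` over `F` is a monic polynomial that maps to zero in `K`.
  have hX : algebraMap F[X] K Polynomial.X ∉ (integralClosure F K).toSubring := by
    rintro ⟨p, hp, h⟩
    have h1 : Polynomial.eval₂ f (algebraMap F[X] K Polynomial.X) p = algebraMap F[X] K p := by
      rw [← Polynomial.hom_eval₂, Polynomial.eval₂_C_X]
    have h2 : algebraMap F[X] K p = 0 := h1.symm.trans h
    exact hp.ne_zero (hinj (h2.trans (map_zero _).symm))
  have : IsIntegrallyClosedIn (integralClosure F K).toSubring K :=
    inferInstanceAs (IsIntegrallyClosedIn (integralClosure F K) K)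
  obtain ⟨V, hV, hXV⟩ := Subring.exists_le_valuationSubring_of_isIntegrallyClosedIn hX
  refine ⟨V, ?_, fun c ↦ ?_⟩
  · rw [← not_le, V.valuation_le_one_iff]; exact hXV
  · rw [V.valuation_le_one_iff]
    exact hV ((integralClosure F K).algebraMap_mem c)

variable {Γ : Type*} [LinearOrderedCommGroupWithZero Γ] {v : Valuation K Γ}
  (hX : 1 < v (algebraMap F[X] K Polynomial.X))
  (hC : ∀ c : F, v (algebraMap F[X] K (Polynomial.C c)) ≤ 1)

include hC in
theorem valuation_C_eq_one {c : F} (hc : c ≠ 0) : v (algebraMap F[X] K (Polynomial.C c)) = 1 := by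
  refine le_antisymm (hC c) ?_
  have : v (algebraMap F[X] K (Polynomial.C c)) * v (algebraMap F[X] K (Polynomial.C c⁻¹)) = 1 := by
    rw [← map_mul, ← map_mul, ← Polynomial.C_mul, mul_inv_cancel₀ hc]; simp
  rw [← this]
  exact mul_le_of_le_one_right' (hC _)

include hX hC in
theorem valuation_le_pow {p : F[X]} {n : ℕ} (hp : p.natDegree ≤ n) :
    v (algebraMap F[X] K p) ≤ v (algebraMap F[X] K Polynomial.X) ^ n := by
  rw [p.as_sum_range_C_mul_X_pow, map_sum]
  refine Valuation.map_sum_le _ fun i hi ↦ ?_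
  rw [map_mul, map_mul, map_pow, map_pow]
  refine (mul_le_of_le_one_left' (hC _)).trans (pow_le_pow_right₀ hX.le ?_)
  have := Finset.mem_range.1 hi
  omega

include hX hC in
theorem valuation_eq_pow_natDegree {p : F[X]} (hp : p ≠ 0) :
    v (algebraMap F[X] K p) = v (algebraMap F[X] K Polynomial.X) ^ p.natDegree := by
  have hlead : v (algebraMap F[X] K (Polynomial.C p.leadingCoeff * Polynomial.X ^ p.natDegree)) =
      v (algebraMap F[X] K Polynomial.X) ^ p.natDegree := by
    rw [map_mul, map_mul, valuation_C_eq_one hC (Polynomial.leadingCoeff_ne_zero.2 hp), one_mul,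
      map_pow, map_pow]
  have hX0 : 0 < v (algebraMap F[X] K Polynomial.X) := zero_lt_one.trans hX
  conv_lhs => rw [← p.eraseLead_add_C_mul_X_pow, map_add]
  rw [← hlead]
  refine v.map_add_eq_of_lt_right ?_
  rw [hlead]
  rcases eq_or_ne p.eraseLead 0 with h | h
  · rw [h, map_zero, map_zero]; exact pow_pos hX0 _
  · have h1 : p.eraseLead.natDegree < p.natDegree := by
      refine Polynomial.eraseLead_natDegree_lt ?_
      by_contra h2
      exact h (Polynomial.card_support_eq_zero.1 (by rw [Polynomial.card_support_eraseLead]; omega))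
    exact (valuation_le_pow hX hC le_rfl).trans_lt (pow_lt_pow_right₀ hX h1)

include hX hC in
theorem one_le_valuation {p : F[X]} (hp : p ≠ 0) : 1 ≤ v (algebraMap F[X] K p) := by
  rw [valuation_eq_pow_natDegree hX hC hp]
  exact one_le_pow₀ hX.le

theorem valuation_add_eq_or_sub_eq {b s : K} (h2 : v 2 = 1) (hs : v s ≤ v b) :
    v (b + s) = v b ∨ v (b + -s) = v b := by
  by_contra! h
  have h1 : v (b + s) < v b := lt_of_le_of_ne (v.map_add_le le_rfl hs) h.1
  have h3 : v (b + -s) < v b :=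
    lt_of_le_of_ne (v.map_add_le le_rfl (by rwa [Valuation.map_neg])) h.2
  have h4 := v.map_add_lt h1 h3
  have : b + s + (b + -s) = 2 * b := by ring
  rw [this, map_mul, h2, one_mul] at h4
  exact lt_irrefl _ h4

end Valuation

/-! ### Conjugation and the integral closure -/

section Quadratic

variable {F K : Type*} [Field F] [Field K] [Algebra F[X] K] [Algebra (RatFunc F) K]
  [IsScalarTower F[X] (RatFunc F) K]

theorem minpoly_sqrt {D : F[X]} (hD : Squarefree D) (hdeg : 0 < D.natDegree) {s : K}
    (hs : s ^ 2 = algebraMap F[X] K D) :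
    minpoly (RatFunc F) s = Polynomial.X ^ 2 - Polynomial.C (algebraMap F[X] (RatFunc F) D) := by
  have hirr : Irreducible
      (Polynomial.X ^ 2 - Polynomial.C (algebraMap F[X] (RatFunc F) D)) := by
    refine (X_pow_sub_C_irreducible_iff_of_prime Nat.prime_two).2 fun b hb ↦ ?_
    have hint : IsIntegral F[X] b := by
      refine ⟨Polynomial.X ^ 2 - Polynomial.C D, Polynomial.monic_X_pow_sub_C _ two_ne_zero, ?_⟩
      simp [hb]
    obtain ⟨p, rfl⟩ := IsIntegrallyClosed.isIntegral_iff.1 hint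
    rw [← map_pow] at hb
    have hp := IsFractionRing.injective F[X] (RatFunc F) hb
    have := hD p ⟨1, by rw [← hp]; ring⟩
    rw [← hp, Polynomial.natDegree_pow, Polynomial.natDegree_eq_zero_of_isUnit this] at hdeg
    exact absurd hdeg (by simp)
  refine (minpoly.eq_of_irreducible_of_monic hirr ?_
    (Polynomial.monic_X_pow_sub_C _ two_ne_zero)).symm
  simp [hs, ← IsScalarTower.algebraMap_apply]

omit [Algebra (RatFunc F) K] [IsScalarTower F[X] (RatFunc F) K] in
theorem isIntegral_sqrt {D : F[X]} {s : K} (hs : s ^ 2 = algebraMap F[X] K D) :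
    IsIntegral F[X] s :=
  ⟨Polynomial.X ^ 2 - Polynomial.C D, Polynomial.monic_X_pow_sub_C _ two_ne_zero, by simp [hs]⟩

theorem exists_conj {D : F[X]} (hD : Squarefree D) (hdeg : 0 < D.natDegree) {s : K}
    (hs : s ^ 2 = algebraMap F[X] K D) (htop : IntermediateField.adjoin (RatFunc F) {s} = ⊤) :
    ∃ σ : K →ₐ[RatFunc F] K, σ s = -s := by
  have hmin := minpoly_sqrt hD hdeg hs
  have hint : IsIntegral (RatFunc F) s := (isIntegral_sqrt hs).tower_top
  refine IntermediateField.exists_algHom_of_adjoin_splits_of_aeval (S := {s}) ?_ htop ?_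
  · intro x hx
    rw [Set.mem_singleton_iff.1 hx]
    refine ⟨hint, ?_⟩
    rw [hmin]
    have : (Polynomial.X ^ 2 - Polynomial.C (algebraMap F[X] (RatFunc F) D)).map
        (algebraMap (RatFunc F) K) = (Polynomial.X - Polynomial.C s) *
          (Polynomial.X + Polynomial.C s) := by
      simp only [Polynomial.map_sub, Polynomial.map_pow, Polynomial.map_X, Polynomial.map_C,
        ← IsScalarTower.algebraMap_apply, ← hs]
      rw [Polynomial.C_pow]; ring
    rw [this]
    exact (Polynomial.Splits.X_sub_C _).mul (Polynomial.Splits.X_add_C _)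
  · rw [hmin]; simp [hs, ← IsScalarTower.algebraMap_apply]

theorem exists_eq_add_mul_sqrt {D : F[X]} {s : K} (hs : s ^ 2 = algebraMap F[X] K D)
    (htop : IntermediateField.adjoin (RatFunc F) {s} = ⊤) (z : K) :
    ∃ a b : RatFunc F, z = algebraMap (RatFunc F) K a + algebraMap (RatFunc F) K b * s := by
  have hint : IsIntegral (RatFunc F) s := (isIntegral_sqrt hs).tower_top
  have hz : z ∈ Algebra.adjoin (RatFunc F) {s} := by
    rw [← IntermediateField.adjoin_simple_toSubalgebra_of_isAlgebraic hint.isAlgebraic, htop]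
    trivial
  induction hz using Algebra.adjoin_induction with
  | mem x hx => exact ⟨0, 1, by rw [Set.mem_singleton_iff.1 hx]; simp⟩
  | algebraMap r => exact ⟨r, 0, by simp⟩
  | add x y _ _ hx hy =>
    obtain ⟨a, b, rfl⟩ := hx
    obtain ⟨a', b', rfl⟩ := hy
    exact ⟨a + a', b + b', by simp only [map_add]; ring⟩
  | mul x y _ _ hx hy =>
    obtain ⟨a, b, rfl⟩ := hx
    obtain ⟨a', b', rfl⟩ := hy
    refine ⟨a * a' + b * b' * algebraMap F[X] (RatFunc F) D, a * b' + a' * b, ?_⟩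
    simp only [map_add, map_mul, ← IsScalarTower.algebraMap_apply, ← hs]; ring

variable (h2 : (2 : F) ≠ 0) {D : F[X]} (hD : Squarefree D) {s : K}
  (hs : s ^ 2 = algebraMap F[X] K D) {σ : K →ₐ[RatFunc F] K} (hσ : σ s = -s)

theorem conj_algebraMap (p : F[X]) : σ (algebraMap F[X] K p) = algebraMap F[X] K p := by
  rw [IsScalarTower.algebraMap_apply F[X] (RatFunc F) K, σ.commutes]

theorem IsIntegral.conj {z : K} (hz : IsIntegral F[X] z) : IsIntegral F[X] (σ z) :=
  hz.map (σ.restrictScalars F[X])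

include h2 hD hs hσ in
/-- The integral closure of `F[X]` in `F(X)(√D)` is `F[X][√D]`. -/
theorem exists_eq_add_mul_sqrt_of_isIntegral
    (htop : IntermediateField.adjoin (RatFunc F) {s} = ⊤) {z : K} (hz : IsIntegral F[X] z) :
    ∃ x y : F[X], z = algebraMap F[X] K x + algebraMap F[X] K y * s := by
  obtain ⟨a, b, hab⟩ := exists_eq_add_mul_sqrt hs htop z
  have hconj : σ z = algebraMap (RatFunc F) K a - algebraMap (RatFunc F) K b * s := by
    rw [hab, map_add, map_mul, σ.commutes, σ.commutes, hσ]; ring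
  have hinj : Function.Injective (algebraMap (RatFunc F) K) := (algebraMap (RatFunc F) K).injective
  have descend : ∀ r : RatFunc F, IsIntegral F[X] (algebraMap (RatFunc F) K r) →
      ∃ p : F[X], algebraMap F[X] (RatFunc F) p = r := fun r hr ↦
    IsIntegrallyClosed.isIntegral_iff.1 ((isIntegral_algebraMap_iff hinj).1 hr)
  obtain ⟨p, hp⟩ := descend (2 * a) (by
    have e : algebraMap (RatFunc F) K (2 * a) = z + σ z := by
      rw [hconj, hab, map_mul, map_ofNat]; ring
    rw [e]
    exact hz.add (hz.conj (σ := σ)))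
  obtain ⟨t, ht⟩ := descend (2 * b * algebraMap F[X] (RatFunc F) D) (by
    have e : algebraMap (RatFunc F) K (2 * b * algebraMap F[X] (RatFunc F) D) = (z - σ z) * s := by
      rw [hconj, hab, map_mul, map_mul, map_ofNat, ← IsScalarTower.algebraMap_apply, ← hs]; ring
    rw [e]
    exact (hz.sub (hz.conj (σ := σ))).mul (isIntegral_sqrt hs))
  obtain ⟨r, hr⟩ := descend ((2 * b) ^ 2 * algebraMap F[X] (RatFunc F) D) (by
    have e : algebraMap (RatFunc F) K ((2 * b) ^ 2 * algebraMap F[X] (RatFunc F) D) =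
        (z - σ z) ^ 2 := by
      rw [hconj, hab, map_mul, map_pow, map_mul, map_ofNat, ← IsScalarTower.algebraMap_apply, ← hs]
      ring
    rw [e]
    exact (hz.sub (hz.conj (σ := σ))).pow 2)
  have htD : t ^ 2 = D * r := by
    apply IsFractionRing.injective F[X] (RatFunc F)
    rw [map_pow, map_mul, ht, hr]; ring
  -- Here `t = 2 * b * D` and `r = (2 * b) ^ 2 * D`. Square-freeness turns `D ∣ t ^ 2` into `D ∣ t`,
  -- so `2 * b` is a polynomial.
  obtain ⟨q, rfl⟩ := (hD.dvd_pow_iff_dvd two_ne_zero).1 ⟨r, htD⟩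
  have hD0 : algebraMap F[X] (RatFunc F) D ≠ 0 := by
    rw [Ne, map_eq_zero_iff _ (IsFractionRing.injective F[X] (RatFunc F))]
    exact hD.ne_zero
  have hq : algebraMap F[X] (RatFunc F) q = 2 * b := by
    rw [map_mul, mul_comm] at ht
    exact mul_right_cancel₀ hD0 ht
  have h2' : algebraMap F[X] (RatFunc F) (Polynomial.C (2⁻¹ : F)) * 2 = 1 := by
    rw [← map_ofNat (algebraMap F[X] (RatFunc F)) 2, ← map_mul, ← map_ofNat Polynomial.C 2,
      ← Polynomial.C_mul, inv_mul_cancel₀ h2]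
    simp
  have half : ∀ {p : F[X]} {a : RatFunc F}, algebraMap F[X] (RatFunc F) p = 2 * a →
      algebraMap F[X] K (Polynomial.C 2⁻¹ * p) = algebraMap (RatFunc F) K a := by
    intro p a hp
    rw [IsScalarTower.algebraMap_apply F[X] (RatFunc F) K, map_mul, hp, ← mul_assoc, h2', one_mul]
  exact ⟨Polynomial.C 2⁻¹ * p, Polynomial.C 2⁻¹ * q, by rw [hab, half hp, half hq]⟩

end Quadratic

/-! ### The unit, and reduction modulo its powers -/

section Quadratic

variable {F K : Type*} [Field F] [Field K] [Algebra F[X] K] [Algebra (RatFunc F) K]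
  [IsScalarTower F[X] (RatFunc F) K]

/-- The unit `(B + c + s) * (B + s) ^ m / A ^ m`. -/
theorem exists_unit_of_sqrt (h2 : (2 : F) ≠ 0) {A B D c e : F[X]} {m : ℕ} (hA0 : A ≠ 0)
    (hc : c ^ 2 = 1) (he : e ^ 2 = 1) (hB : 2 * B = 2 * A ^ m + c * (e * A - 1))
    (hD : D = B ^ 2 + e * A) {s : K} (hs : s ^ 2 = algebraMap F[X] K D)
    {σ : K →ₐ[RatFunc F] K} (hσ : σ s = -s) :
    ∃ u : (FunctionField.ringOfIntegers F K)ˣ,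
      ((u : FunctionField.ringOfIntegers F K) : K) * algebraMap F[X] K A ^ m =
        (algebraMap F[X] K (B + c) + s) * (algebraMap F[X] K B + s) ^ m ∧
      ((u : FunctionField.ringOfIntegers F K) : K) * σ (u : FunctionField.ringOfIntegers F K) =
        algebraMap F[X] K (2 * c * (-e) ^ m) := by
  set φ := algebraMap F[X] K with hφ
  have hA' : φ A ≠ 0 := by
    rwa [Ne, map_eq_zero_iff _ (FunctionField.algebraMap_injective F K)]
  have hθθ : (φ B + s) * (φ B - s) = φ (-e * A) := by
    have h := congrArg φ hD
    rw [← hs] at h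
    simp only [map_add, map_mul, map_pow, map_neg] at h ⊢
    linear_combination -h
  have hηη : (φ (B + c) + s) * (φ (B + c) - s) = φ (2 * c * A ^ m) := by
    have h : (B + c) ^ 2 - D = 2 * c * A ^ m := by
      rw [hD]; linear_combination c * hB + (e * A) * hc
    rw [← h, map_sub, ← hs, map_pow]; ring
  obtain ⟨x, y, hxy⟩ := exists_mul_pow_eq (K := K) hc hB hD 1 0 m le_rfl
  have h1 := hxy (-s) (by rw [neg_sq, hs])
  rw [← hφ, map_one, map_zero, zero_mul, add_zero, one_mul, sub_neg_eq_add] at h1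
  -- By `h1`, `(B + s) ^ m = x * A ^ m + y * (B + c - s)`. Multiplying by `B + c + s` makes both
  -- terms divisible by `A ^ m`; the quotient is visibly integral.
  set ε : K := φ x * (φ (B + c) + s) + φ (2 * c * y) with hε
  have hεA : ε * φ A ^ m = (φ (B + c) + s) * (φ B + s) ^ m := by
    rw [h1, hε]
    simp only [map_mul, map_pow] at hηη ⊢
    linear_combination -(φ y) * hηη
  have hint : IsIntegral F[X] ε :=
    (isIntegral_algebraMap.mul (isIntegral_algebraMap.add (isIntegral_sqrt hs))).add
      isIntegral_algebraMap
  have hσε : σ ε * φ A ^ m = (φ (B + c) - s) * (φ B - s) ^ m := by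
    have := congrArg σ hεA
    simpa only [map_mul, map_pow, map_add, hσ, conj_algebraMap, hφ, sub_eq_add_neg] using this
  have hN : ε * σ ε = φ (2 * c * (-e) ^ m) := by
    apply mul_right_cancel₀ (pow_ne_zero (2 * m) hA')
    calc ε * σ ε * φ A ^ (2 * m) = (ε * φ A ^ m) * (σ ε * φ A ^ m) := by ring
      _ = ((φ (B + c) + s) * (φ (B + c) - s)) * ((φ B + s) * (φ B - s)) ^ m := by
        rw [hεA, hσε, mul_pow]; ring
      _ = φ (2 * c * (-e) ^ m) * φ A ^ (2 * m) := by
        rw [hηη, hθθ]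
        simp only [map_mul, map_pow, mul_pow]; ring
  have hinv : ε * (σ ε * φ (Polynomial.C 2⁻¹ * c * (-e) ^ m)) = 1 := by
    rw [← mul_assoc, hN, ← map_mul, ← map_one φ]
    congr 1
    have h3 : Polynomial.C (2⁻¹ : F) * 2 = 1 := by
      rw [← map_ofNat Polynomial.C 2, ← Polynomial.C_mul, inv_mul_cancel₀ h2, map_one]
    have h4 : (-e) ^ m * (-e) ^ m = 1 := by rw [← mul_pow, neg_mul_neg, ← sq, he, one_pow]
    calc _ = (Polynomial.C (2⁻¹ : F) * 2) * c ^ 2 * ((-e) ^ m * (-e) ^ m) := by ring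
      _ = 1 := by rw [h3, hc, h4]; simp
  exact ⟨⟨⟨ε, hint⟩, ⟨_, (hint.conj (σ := σ)).mul isIntegral_algebraMap⟩, Subtype.ext hinv,
    Subtype.ext ((mul_comm _ _).trans hinv)⟩, hεA, hN⟩

theorem exists_mul_conj_eq (h2 : (2 : F) ≠ 0) {D : F[X]} (hD : Squarefree D) {s : K}
    (hs : s ^ 2 = algebraMap F[X] K D) {σ : K →ₐ[RatFunc F] K} (hσ : σ s = -s)
    (htop : IntermediateField.adjoin (RatFunc F) {s} = ⊤) {z : K} (hz : IsIntegral F[X] z) :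
    ∃ n : F[X], z * σ z = algebraMap F[X] K n := by
  obtain ⟨x, y, rfl⟩ := exists_eq_add_mul_sqrt_of_isIntegral h2 hD hs hσ htop hz
  refine ⟨x ^ 2 - D * y ^ 2, ?_⟩
  simp only [map_add, map_mul, map_sub, map_pow, conj_algebraMap, hσ, ← hs]; ring

/-- An element of the integral closure whose norm has degree less than `deg A` is a unit times
a polynomial. -/
theorem exists_eq_mul_unit_of_natDegree_lt (h2 : (2 : F) ≠ 0) {A B D c e : F[X]} {m : ℕ}
    (hm : 1 ≤ m) (hc : c ^ 2 = 1) (he : e ^ 2 = 1)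
    (hB : 2 * B = 2 * A ^ m + c * (e * A - 1)) (hD : D = B ^ 2 + e * A)
    (hsq : Squarefree D) (hAdeg : 0 < A.natDegree) (hBdeg : B.natDegree = m * A.natDegree)
    (hDdeg : D.natDegree = 2 * B.natDegree)
    {s : K} (hs : s ^ 2 = algebraMap F[X] K D) {σ : K →ₐ[RatFunc F] K} (hσ : σ s = -s)
    (htop : IntermediateField.adjoin (RatFunc F) {s} = ⊤) {z : K} (hz : IsIntegral F[X] z)
    (hz0 : z ≠ 0) {n : F[X]} (hn : z * σ z = algebraMap F[X] K n)
    (hdeg : n.natDegree < A.natDegree) :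
    ∃ (x : F[X]) (u : (FunctionField.ringOfIntegers F K)ˣ),
      z = algebraMap F[X] K x * (u : FunctionField.ringOfIntegers F K) := by
  have hinj := FunctionField.algebraMap_injective F K
  obtain ⟨V, hX, hC⟩ := exists_valuationSubring_infty hinj
  set v := V.valuation
  have hpow := fun {p : F[X]} (hp : p ≠ 0) ↦ valuation_eq_pow_natDegree hX hC hp
  have hone := fun (p : F[X]) (hp : p ≠ 0) ↦ one_le_valuation hX hC hp
  have hA0 : A ≠ 0 := by rintro rfl; simp at hAdeg
  have hBpos : 0 < B.natDegree := by rw [hBdeg]; exact Nat.mul_pos hm hAdeg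
  have hB0 : B ≠ 0 := by rintro rfl; simp at hBpos
  have hv2 : v 2 = 1 := by
    have := valuation_C_eq_one hC h2
    rwa [map_ofNat, map_ofNat] at this
  have hgA : 1 < v (algebraMap F[X] K A) := by
    rw [hpow hA0]; exact one_lt_pow₀ hX hAdeg.ne'
  have hvB : v (algebraMap F[X] K B) = v (algebraMap F[X] K A) ^ m := by
    rw [hpow hB0, hpow hA0, hBdeg, ← pow_mul, mul_comm]
  have hvs : v s = v (algebraMap F[X] K A) ^ m := by
    have h1 : v s ^ 2 = (v (algebraMap F[X] K B)) ^ 2 := by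
      rw [← map_pow, hs, hpow hsq.ne_zero, hDdeg, hpow hB0, ← pow_mul, mul_comm 2]
    rw [← hvB]
    exact (pow_left_inj₀ zero_le zero_le two_ne_zero).1 h1
  -- The sign of the square root is chosen so that `B + t` does not cancel at the chosen place.
  obtain ⟨t, ht, hσt, htopt, hvt, hBt⟩ : ∃ t : K, t ^ 2 = algebraMap F[X] K D ∧ σ t = -t ∧
      IntermediateField.adjoin (RatFunc F) {t} = ⊤ ∧ v t = v (algebraMap F[X] K A) ^ m ∧
      v (algebraMap F[X] K B + t) = v (algebraMap F[X] K A) ^ m := by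
    rcases valuation_add_eq_or_sub_eq hv2 (hvs.trans hvB.symm).le with h | h
    · exact ⟨s, hs, hσ, htop, hvs, h.trans hvB⟩
    · refine ⟨-s, by rw [neg_sq, hs], by rw [map_neg, hσ], ?_, by rw [Valuation.map_neg, hvs],
        h.trans hvB⟩
      rw [eq_top_iff, ← htop, IntermediateField.adjoin_simple_le_iff]
      have := IntermediateField.mem_adjoin_simple_self (RatFunc F) (-s)
      simpa using neg_mem this
  obtain ⟨u, hu, hu'⟩ := exists_unit_of_sqrt h2 hA0 hc he hB hD ht hσt
  set ε : K := ((u : FunctionField.ringOfIntegers F K) : K) with hε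
  set g := v (algebraMap F[X] K A) with hg
  have hg0 : 0 < g := zero_lt_one.trans hgA
  have hvc : v (algebraMap F[X] K c) = 1 :=
    Valuation.eq_one_of_sq (by rw [← map_pow, hc, map_one])
  have hvε : v ε = g ^ (m * m) := by
    have h1 : v (algebraMap F[X] K (B + c) + t) = g ^ m := by
      have h3 : algebraMap F[X] K (B + c) + t =
          (algebraMap F[X] K B + t) + algebraMap F[X] K c := by rw [map_add]; ring
      rw [h3, ← hBt]
      refine v.map_add_eq_of_lt_left ?_
      rw [hvc, hBt]
      exact one_lt_pow₀ hgA (by omega)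
    have h3 := congrArg v hu
    rw [map_mul, map_pow, map_mul, map_pow, h1, hBt, ← hg, mul_comm, ← pow_mul] at h3
    exact mul_left_cancel₀ (pow_ne_zero m hg0.ne') h3
  have hbound : ∀ w : K, IsIntegral F[X] w → ∃ N : ℕ, v w ≤ v ε ^ N := by
    intro w hw
    obtain ⟨x, y, rfl⟩ := exists_eq_add_mul_sqrt_of_isIntegral h2 hsq ht hσt htopt hw
    have hXg : ∀ p : F[X], v (algebraMap F[X] K p) ≤ g ^ p.natDegree := fun p ↦ by
      refine (valuation_le_pow hX hC le_rfl).trans (pow_le_pow_left₀ zero_le ?_ _)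
      rw [hg, hpow hA0]
      exact le_self_pow₀ hX.le hAdeg.ne'
    refine ⟨x.natDegree + y.natDegree + m, ?_⟩
    have h1 : g ^ (x.natDegree + y.natDegree + m) ≤ v ε ^ (x.natDegree + y.natDegree + m) := by
      refine pow_le_pow_left₀ zero_le ?_ _
      rw [hvε]
      exact le_self_pow₀ hgA.le (Nat.mul_pos hm hm).ne'
    refine le_trans (v.map_add_le ?_ ?_) h1
    · exact (hXg x).trans (pow_le_pow_right₀ hgA.le (by omega))
    · rw [map_mul, hvt]
      refine (mul_le_mul_left (hXg y) _).trans ?_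
      rw [← pow_add]
      exact pow_le_pow_right₀ hgA.le (by omega)
  have hn0 : n ≠ 0 := by
    rintro rfl
    rw [map_zero, mul_eq_zero, map_eq_zero] at hn
    simp [hz0] at hn
  obtain ⟨N, hN⟩ := hbound z hz
  obtain ⟨N', hN'⟩ := hbound (σ z) (hz.conj (σ := σ))
  have h1ε : 1 < v ε := by rw [hvε]; exact one_lt_pow₀ hgA (Nat.mul_pos hm hm).ne'
  obtain ⟨k, hk1, hk2⟩ := exists_zpow_mem_Ico (by rw [← map_mul, hn]; exact hone n hn0) h1ε hN hN'
  have hcoe : (((u ^ k : (FunctionField.ringOfIntegers F K)ˣ) :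
      FunctionField.ringOfIntegers F K) : K) = ε ^ k := by
    have := map_zpow (Units.map ((FunctionField.ringOfIntegers F K).val : _ →* K)) u k
    have := congrArg Units.val this
    rwa [Units.val_zpow_eq_zpow_val] at this
  have hε0 : ε ≠ 0 := fun h ↦ by
    rw [h, map_zero] at h1ε; exact absurd h1ε (not_lt.2 zero_le_one)
  have hint : IsIntegral F[X] (z * ε ^ k) := by
    rw [← hcoe]
    exact hz.mul (u ^ k : (FunctionField.ringOfIntegers F K)ˣ).val.2
  obtain ⟨x, y, hxy⟩ := exists_eq_add_mul_sqrt_of_isIntegral h2 hsq ht hσt htopt hint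
  have hxy' : σ (z * ε ^ k) = algebraMap F[X] K x - algebraMap F[X] K y * t := by
    rw [hxy, map_add, map_mul, conj_algebraMap, conj_algebraMap, hσt]; ring
  have hy : y = 0 := by
    refine coeff_eq_zero_of_small_norm (v := v) hone hinj hv2 hm hc he hB hD ht hgA hvt hBt x y
      ?_ ?_ ?_
    · rw [← hxy, map_mul, map_zpow₀]; exact hk1
    · rw [← hxy, map_mul, map_zpow₀, ← hg, ← hvε]; exact hk2
    -- The norm of `ε` is a nonzero constant, so the valuation of the norm is unchanged.
    · have h3 : z * ε ^ k * σ (z * ε ^ k) = algebraMap F[X] K n * (ε * σ ε) ^ k := by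
        rw [map_mul, map_zpow₀, ← hn, mul_zpow]; ring
      have h4 : v (ε * σ ε) = 1 := by
        have hve : v (algebraMap F[X] K (-e)) = 1 :=
          Valuation.eq_one_of_sq (by rw [← map_pow, neg_sq, he, map_one])
        rw [hu', map_mul, map_mul (algebraMap F[X] K) 2 c, map_ofNat, map_mul v, map_mul v, map_pow, map_pow, hv2, hvc, hve,
          one_mul, one_mul, one_pow]
      rw [← hxy, ← hxy', h3, map_mul, map_zpow₀, h4, one_zpow, mul_one, hpow hn0, hpow hA0]
      exact pow_lt_pow_right₀ hX hdeg
  refine ⟨x, (u ^ k)⁻¹, ?_⟩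
  rw [hy, map_zero, zero_mul, add_zero] at hxy
  rw [← hxy, ← zpow_neg]
  have hcoe' : (((u ^ (-k) : (FunctionField.ringOfIntegers F K)ˣ) :
      FunctionField.ringOfIntegers F K) : K) = ε ^ (-k) := by
    have := map_zpow (Units.map ((FunctionField.ringOfIntegers F K).val : _ →* K)) u (-k)
    have := congrArg Units.val this
    rwa [Units.val_zpow_eq_zpow_val] at this
  rw [hcoe', mul_assoc, ← zpow_add₀ hε0]; simp

end Quadratic

/-! ### Primes above a split polynomial -/

section Splitting

variable {R O : Type*} [CommRing R] [IsPrincipalIdealRing R] [CommRing O]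
  [IsDedekindDomain O] [Algebra R O]

/-- If `P` splits, no positive power of a prime above `P` is generated by an element of the
base ring. -/
theorem pow_ne_span_algebraMap (hinj : Function.Injective (algebraMap R O)) {P : R}
    (hP : Irreducible P) {p q : Ideal O} (hp : p.IsPrime) (hq : q.IsPrime) (hpq : p ≠ q)
    (hPO : Ideal.span {algebraMap R O P} = p * q) {h : ℕ} (hh : h ≠ 0) (x : R) :
    p ^ h ≠ Ideal.span {algebraMap R O x} := by
  intro hx
  have hP0 : algebraMap R O P ≠ 0 := by
    rw [Ne, map_eq_zero_iff _ hinj]; exact hP.ne_zero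
  have hpq0 : p * q ≠ ⊥ := by
    rw [← hPO, Ne, Ideal.span_singleton_eq_bot]; exact hP0
  have hp0 : p ≠ ⊥ := by rintro rfl; simp at hpq0
  have hPpq : algebraMap R O P ∈ p * q := by
    rw [← hPO]; exact Ideal.mem_span_singleton_self _
  have hPp : algebraMap R O P ∈ p := (Ideal.mul_le_left : p * q ≤ p) hPpq
  have hxp : algebraMap R O x ∈ p := by
    refine Ideal.pow_le_self hh ?_
    rw [hx]; exact Ideal.mem_span_singleton_self _
  -- Otherwise a Bézout relation between `P` and `x` puts 1 in `p`.
  have hdvd : P ∣ x := by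
    rw [hP.dvd_iff_not_isCoprime]
    rintro ⟨a, b, hab⟩
    apply hp.ne_top
    rw [Ideal.eq_top_iff_one, ← map_one (algebraMap R O), ← hab, map_add, map_mul, map_mul]
    exact p.add_mem (p.mul_mem_left _ hPp) (p.mul_mem_left _ hxp)
  -- As `P ∣ x`, the ideal `p ^ h` lies in `(P)`, hence in `q`; maximality of `p` then gives `p =
  -- q`.
  have hle : p ^ h ≤ q := by
    rw [hx, Ideal.span_singleton_le_iff_mem]
    obtain ⟨y, rfl⟩ := hdvd
    rw [map_mul]
    exact q.mul_mem_right _ ((Ideal.mul_le_right : p * q ≤ q) hPpq)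
  exact hpq ((hp.isMaximal hp0).eq_of_le hq.ne_top (hq.le_of_pow_le hle))

theorem isPrincipal_pow_card_classGroup [Finite (ClassGroup O)] {p : Ideal O} (hp : p ≠ ⊥) :
    (p ^ Nat.card (ClassGroup O)).IsPrincipal := by
  have hmem : p ∈ nonZeroDivisors (Ideal O) := mem_nonZeroDivisors_of_ne_zero hp
  rw [← ClassGroup.mk0_eq_one_iff (pow_mem hmem _)]
  have h1 := pow_card_eq_one' (x := ClassGroup.mk0 ⟨p, hmem⟩)
  rw [← map_pow] at h1
  exact h1

end Splitting

/-! ### The class number bound -/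

section Quadratic

variable {F K : Type*} [Field F] [Field K] [Algebra F[X] K] [Algebra (RatFunc F) K]
  [IsScalarTower F[X] (RatFunc F) K]

theorem finiteDimensional_of_sqrt {D : F[X]} {s : K} (hs : s ^ 2 = algebraMap F[X] K D)
    (htop : IntermediateField.adjoin (RatFunc F) {s} = ⊤) : FunctionField F K := by
  have hint : IsIntegral (RatFunc F) s := (isIntegral_sqrt hs).tower_top
  have := IntermediateField.adjoin.finiteDimensional hint
  rw [htop] at this
  exact IntermediateField.topEquiv.toLinearEquiv.finiteDimensional

theorem isSeparable_of_sqrt (h2 : (2 : F) ≠ 0) {D : F[X]} (hD : Squarefree D)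
    (hdeg : 0 < D.natDegree) {s : K} (hs : s ^ 2 = algebraMap F[X] K D)
    (htop : IntermediateField.adjoin (RatFunc F) {s} = ⊤) :
    Algebra.IsSeparable (RatFunc F) K := by
  have hsep : IsSeparable (RatFunc F) s := by
    rw [IsSeparable, minpoly_sqrt hD hdeg hs]
    refine Polynomial.separable_X_pow_sub_C _ ?_ ?_
    · have h : algebraMap F (RatFunc F) 2 ≠ 0 := by
        rwa [Ne, map_eq_zero]
      rw [map_ofNat] at h
      exact_mod_cast h
    · rw [Ne, map_eq_zero_iff _ (IsFractionRing.injective F[X] (RatFunc F))]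
      exact hD.ne_zero
  rw [← separableClosure.eq_top_iff, eq_top_iff, ← htop,
    IntermediateField.adjoin_simple_le_iff]
  exact mem_separableClosure_iff.2 hsep

theorem natDegree_div_natDegree_le_idealClassNumber [Finite F] (h2 : (2 : F) ≠ 0)
    {A B D P c e : F[X]} {m : ℕ} (hm : 1 ≤ m) (hc : c ^ 2 = 1) (he : e ^ 2 = 1)
    (hB : 2 * B = 2 * A ^ m + c * (e * A - 1)) (hD : D = B ^ 2 + e * A)
    (hsq : Squarefree D) (hAdeg : 0 < A.natDegree) (hBdeg : B.natDegree = m * A.natDegree)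
    (hP : Irreducible P) (hK : IsAdjoinSqrt F K D) (hsplit : SplitsInQuadratic F K P) :
    (idealClassNumber F K : ℚ) ≥ (A.natDegree : ℚ) / (P.natDegree : ℚ) := by
  have hDdeg : D.natDegree = 2 * B.natDegree := by
    have h1 : (e * A).natDegree < (B ^ 2).natDegree := by
      have he0 : e.natDegree = 0 :=
        Polynomial.natDegree_eq_zero_of_isUnit (IsUnit.of_mul_eq_one e (by rw [← sq, he]))
      have h3 : (e * A).natDegree ≤ A.natDegree := Polynomial.natDegree_mul_le.trans (by omega)
      rw [Polynomial.natDegree_pow, hBdeg]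
      nlinarith
    rw [hD, Polynomial.natDegree_add_eq_left_of_natDegree_lt h1, Polynomial.natDegree_pow]
  have hDpos : 0 < D.natDegree := by
    rw [hDdeg, hBdeg]; positivity
  obtain ⟨s, hs, htop⟩ := hK
  obtain ⟨σ, hσ⟩ := exists_conj hsq hDpos hs htop
  have := Fintype.ofFinite F
  have := finiteDimensional_of_sqrt hs htop
  have := isSeparable_of_sqrt h2 hsq hDpos hs htop
  set O := FunctionField.ringOfIntegers F K
  have hinjO : Function.Injective (algebraMap F[X] O) :=
    FunctionField.ringOfIntegers.algebraMap_injective F K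
  obtain ⟨p, q, hp, hq, hpq, hPO⟩ := hsplit
  set h := idealClassNumber F K with hh
  have hcard : h = Nat.card (ClassGroup O) := rfl
  have hh0 : h ≠ 0 := by rw [hcard]; exact Nat.card_pos.ne'
  have hPdeg : 0 < P.natDegree := hP.natDegree_pos
  by_contra hlt
  have hlt' : h * P.natDegree < A.natDegree := by
    rw [ge_iff_le, div_le_iff₀ (by exact_mod_cast hPdeg), not_le] at hlt
    exact_mod_cast hlt
  have hP0 : algebraMap F[X] O P ≠ 0 := by
    rw [Ne, map_eq_zero_iff _ hinjO]; exact hP.ne_zero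
  have hpq0 : p * q ≠ ⊥ := by
    rw [← hPO, Ne, Ideal.span_singleton_eq_bot]; exact hP0
  -- Stated for an arbitrary ordered pair, so that it applies to both primes. Comparing the two
  -- norms with `P ^ (2 * h)` avoids computing the norm of either prime.
  have key : ∀ p q : Ideal O, p.IsPrime → q.IsPrime → p ≠ q →
      Ideal.span {algebraMap F[X] O P} = p * q → ∀ α : O, α ≠ 0 → p ^ h = Ideal.span {α} →
      ∀ n : F[X], (α : K) * σ (α : K) = algebraMap F[X] K n → h * P.natDegree < n.natDegree := by
    intro p q hp hq hpq hPO α hα0 hα n hn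
    by_contra hdeg
    obtain ⟨x, u, hxu⟩ := exists_eq_mul_unit_of_natDegree_lt h2 hm hc he hB hD hsq hAdeg hBdeg
      hDdeg hs hσ htop α.2 (by simpa using hα0) hn (by omega)
    refine pow_ne_span_algebraMap hinjO hP hp hq hpq hPO hh0 x ?_
    rw [hα, Ideal.span_singleton_eq_span_singleton]
    have hαx : α = algebraMap F[X] O x * u := Subtype.ext hxu
    rw [hαx]
    exact (associated_mul_unit_right _ _ u.isUnit).symm
  obtain ⟨α, hα⟩ := (isPrincipal_pow_card_classGroup (O := O) (left_ne_zero_of_mul hpq0)).principal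
  obtain ⟨β, hβ⟩ := (isPrincipal_pow_card_classGroup (O := O) (right_ne_zero_of_mul hpq0)).principal
  rw [← hcard] at hα hβ
  have hassoc : Associated (α * β) (algebraMap F[X] O P ^ h) := by
    rw [← Ideal.span_singleton_eq_span_singleton, ← Ideal.span_singleton_mul_span_singleton,
      ← Ideal.span_singleton_pow, hPO, mul_pow, hα, hβ]
  obtain ⟨w, hw⟩ := hassoc
  have hne : α * β ≠ 0 := by
    intro h0
    rw [h0, zero_mul] at hw
    exact pow_ne_zero h hP0 hw.symm
  obtain ⟨n₁, hn₁⟩ := exists_mul_conj_eq h2 hsq hs hσ htop α.2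
  obtain ⟨n₂, hn₂⟩ := exists_mul_conj_eq h2 hsq hs hσ htop β.2
  -- Only `n₃.natDegree ≥ 0` is needed: `n₁` and `n₂` alone already exceed the total degree `2 * h *
  -- P.natDegree`.
  obtain ⟨n₃, hn₃⟩ := exists_mul_conj_eq h2 hsq hs hσ htop (w : O).2
  have hprod : n₁ * n₂ * n₃ = P ^ (2 * h) := by
    apply FunctionField.algebraMap_injective F K
    have hwK : (α : K) * β * (w : O) = algebraMap F[X] K P ^ h := congrArg Subtype.val hw
    have hwσ := congrArg σ hwK
    rw [map_pow, conj_algebraMap, map_mul, map_mul] at hwσ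
    rw [map_mul, map_mul, ← hn₁, ← hn₂, ← hn₃, map_pow, two_mul, pow_add]
    nth_rw 1 [← hwK]
    rw [← hwσ]; ring
  have hP2 : n₁ * n₂ * n₃ ≠ 0 := by rw [hprod]; exact pow_ne_zero _ hP.ne_zero
  have hdegs := congrArg Polynomial.natDegree hprod
  rw [Polynomial.natDegree_mul (left_ne_zero_of_mul hP2) (right_ne_zero_of_mul hP2),
    Polynomial.natDegree_mul (left_ne_zero_of_mul (left_ne_zero_of_mul hP2))
      (right_ne_zero_of_mul (left_ne_zero_of_mul hP2)), Polynomial.natDegree_pow, mul_assoc] at hdegs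
  have k1 := key p q hp hq hpq hPO α (left_ne_zero_of_mul hne) hα n₁ hn₁
  have k2 := key q p hq hp hpq.symm (hPO.trans (mul_comm _ _)) β (right_ne_zero_of_mul hne) hβ n₂ hn₂
  omega

end Quadratic

/-! ### The four families -/

/-- For `m = 1` the terms `2 * A ^ m` and `c * e * A` merge, with coefficient `2 + c₀ * e₀`. For `c₀
* e₀ = 1` this is 3, whence the exception in characteristic 3; for `c₀ * e₀ = -1` it is 1. -/
theorem natDegree_eq_of_two_mul_eq {F : Type*} [Field F] (h2 : (2 : F) ≠ 0) {A B c e : F[X]}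
    {m : ℕ} {c₀ e₀ : F} (hAdeg : 0 < A.natDegree) (hm : 1 ≤ m)
    (hc : c = Polynomial.C c₀) (he : e = Polynomial.C e₀)
    (hB : 2 * B = 2 * A ^ m + c * (e * A - 1)) (h : m = 1 → 2 + c₀ * e₀ ≠ 0) :
    B.natDegree = m * A.natDegree := by
  have h1 : (2 * B).natDegree = B.natDegree := by
    rw [← map_ofNat Polynomial.C 2, Polynomial.natDegree_C_mul h2]
  rw [← h1, hB]
  rcases eq_or_lt_of_le hm with rfl | hm
  · have h3 : 2 * A ^ 1 + c * (e * A - 1) = Polynomial.C (2 + c₀ * e₀) * A + Polynomial.C (-c₀) := by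
      rw [hc, he]; simp only [map_add, map_mul, map_neg, map_ofNat]; ring
    rw [h3, Polynomial.natDegree_add_C, Polynomial.natDegree_C_mul (h rfl), one_mul]
  · have h3 : (2 * A ^ m).natDegree = m * A.natDegree := by
      rw [← map_ofNat Polynomial.C 2, Polynomial.natDegree_C_mul h2, Polynomial.natDegree_pow]
    have h4 : (c * (e * A - 1)).natDegree ≤ A.natDegree := by
      rw [hc, he]
      refine (Polynomial.natDegree_C_mul_le _ _).trans ?_
      refine (Polynomial.natDegree_sub_le _ _).trans ?_
      simpa using Polynomial.natDegree_C_mul_le _ _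
    rw [Polynomial.natDegree_add_eq_left_of_natDegree_lt, h3]
    rw [h3]
    nlinarith

theorem theorem3 {F : Type*} [Field F] [Finite F] (hF : ringChar F ≠ 2)
    (a A D P : F[X]) (m : ℕ)
    (ha : a ∉ Set.range (Polynomial.C : F → F[X]))
    (hA : A = 2 * a + 1) (hAmonic : A.Monic) (hm : 1 ≤ m)
    (hD : Squarefree D) (hP : Irreducible P)
    {K : Type*} [Field K] [Algebra F[X] K] [Algebra (RatFunc F) K]
    [IsScalarTower F[X] (RatFunc F) K]
    (hK : IsAdjoinSqrt F K D) (hsplit : SplitsInQuadratic F K P) :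
    (D = (A ^ m + a) ^ 2 + A → ¬ (m = 1 ∧ ringChar F = 3) →
      (idealClassNumber F K : ℚ) ≥ (A.natDegree : ℚ) / (P.natDegree : ℚ)) ∧
    (D = (A ^ m - a) ^ 2 + A →
      (idealClassNumber F K : ℚ) ≥ (A.natDegree : ℚ) / (P.natDegree : ℚ)) ∧
    (D = (A ^ m + a + 1) ^ 2 - A → ¬ (m = 1 ∧ ringChar F = 3) →
      (idealClassNumber F K : ℚ) ≥ (A.natDegree : ℚ) / (P.natDegree : ℚ)) ∧
    (D = (A ^ m - a - 1) ^ 2 - A →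
      (idealClassNumber F K : ℚ) ≥ (A.natDegree : ℚ) / (P.natDegree : ℚ)) := by
  have h2 : (2 : F) ≠ 0 := Ring.two_ne_zero hF
  have hAdeg : 0 < A.natDegree := by
    rw [Nat.pos_iff_ne_zero]
    intro h0
    apply ha
    obtain ⟨r, hr⟩ := Polynomial.natDegree_eq_zero.1 h0
    refine ⟨2⁻¹ * (r - 1), ?_⟩
    rw [map_mul, map_sub, hr, map_one, hA, add_sub_cancel_right, ← mul_assoc,
      ← map_ofNat Polynomial.C 2, ← Polynomial.C_mul, inv_mul_cancel₀ h2, map_one, one_mul]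
  have h3 : ¬ (m = 1 ∧ ringChar F = 3) → m = 1 → (2 : F) + 1 ≠ 0 := by
    intro h hm1 h0
    refine h ⟨hm1, ?_⟩
    have h4 : ringChar F ∣ 3 := ringChar.dvd (by
      have : (3 : F) = 0 := by linear_combination h0
      exact_mod_cast this)
    exact ((Nat.dvd_prime Nat.prime_three).1 h4).resolve_left CharP.ringChar_ne_one
  have main : ∀ (B : F[X]) (c e : F), c ^ 2 = 1 → e ^ 2 = 1 →
      2 * B = 2 * A ^ m + Polynomial.C c * (Polynomial.C e * A - 1) →
      D = B ^ 2 + Polynomial.C e * A → (m = 1 → 2 + c * e ≠ 0) →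
      (idealClassNumber F K : ℚ) ≥ (A.natDegree : ℚ) / (P.natDegree : ℚ) := by
    intro B c e hc he hB hDB hce
    exact natDegree_div_natDegree_le_idealClassNumber h2 hm (by rw [← map_pow, hc, map_one])
      (by rw [← map_pow, he, map_one]) hB hDB hD hAdeg
      (natDegree_eq_of_two_mul_eq h2 hAdeg hm rfl rfl hB hce) hP hK hsplit
  have h1 : m = 1 → (2 : F) + -1 ≠ 0 := fun _ ↦ by norm_num
  -- The signs `(c, e)` are read off from `2 * a = A - 1`.
  refine ⟨fun h hne ↦ main (A ^ m + a) 1 1 ?_ ?_ ?_ ?_ ?_,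
    fun h ↦ main (A ^ m - a) (-1) 1 ?_ ?_ ?_ ?_ ?_,
    fun h hne ↦ main (A ^ m + a + 1) (-1) (-1) ?_ ?_ ?_ ?_ ?_,
    fun h ↦ main (A ^ m - a - 1) 1 (-1) ?_ ?_ ?_ ?_ ?_⟩
  all_goals first
    | (simp; done)
    | (simpa using h3 hne)
    | (simpa using h1)
    | (rw [h]; simp only [map_one, map_neg]; ring)
    | (simp only [map_one, map_neg]; linear_combination -hA)
    | (simp only [map_one, map_neg]; linear_combination hA)
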